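/- Let $n\ge 3$. A tuple $(x_1,\dots,x_n)\in[0,1]^n$ is called cyclic if there exist independent real random variables $U_1,\dots,U_n$ with $P(U_i=U_j)=0$ for all $i\neq j$ such that $P(U_{i+1}>U_i)=x_i$ for $i=1,\dots,n-1$ and $P(U_1>U_n)=x_n$. Let $C_n\subseteq[0,1]^n$ be the set of cyclic $n$-tuples and let $p_n=\operatorname{vol}(C_n)$ be its $n$-dimensional Lebesgue measure, that is, the probability that a uniformly random point of $[0,1]^n$ is a cyclic tuple. Theorem. For every integer $n\ge 4$ the set $C_n$ is Lebesgue measurable and $$1-3\left(\frac{2}{\pi}\right)^n\le p_n\le 1-2\left(\frac14\right)^n .$$ In particular, $p_n$ converges exponentially to $1$ as $n\to\infty$: $p_n\to1$, and there are constants $C>0$ and $0<r<1$ such that $|p_n-1|\le C r^n$ for all $n\ge 4$. -/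

import Mathlib

open MeasureTheory ProbabilityTheory Filter Topology

/-- A tuple `x ∈ [0,1]^n` is cyclic if there are (mutually) independent real random variables
`U i`, `i : Fin n`, on some probability space, with `P(U i = U j) = 0` for `i ≠ j`, such that
`P(U (i+1) > U i) = x i` for all `i`, the index `i + 1` being taken modulo `n`
(`finRotate n` is the map `i ↦ i + 1` modulo `n`, so the last condition is
`P(U 0 > U (n-1)) = x (n-1)`). -/
def IsCyclicTuple {n : ℕ} (x : Fin n → ℝ) : Prop :=
  (∀ i, x i ∈ Set.Icc (0 : ℝ) 1) ∧
  ∃ (Ω : Type) (_ : MeasurableSpace Ω) (P : Measure Ω) (U : Fin n → Ω → ℝ),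
    IsProbabilityMeasure P ∧
    (∀ i, Measurable (U i)) ∧
    iIndepFun U P ∧
    (∀ i j, i ≠ j → P {ω | U i ω = U j ω} = 0) ∧
    ∀ i, P.real {ω | U (finRotate n i) ω > U i ω} = x i

/-- The set of cyclic `n`-tuples, a subset of the cube `[0,1]^n`. -/
def cyclicTuples (n : ℕ) : Set (Fin n → ℝ) := {x | IsCyclicTuple x}

/-- The `n`-dimensional Lebesgue volume of the set of cyclic `n`-tuples: the probability that a
uniformly random point of the unit cube is a cyclic tuple. -/
noncomputable def cyclicProb (n : ℕ) : ℝ :=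
  (volume : Measure (Fin n → ℝ)).real (cyclicTuples n)

/-! Cyclicity depends only on the laws of the variables, and laws can be modified one at a time.
Squeeze all laws into a bounded interval and mix the law of index `k` with a two-point law at the
ends of a larger interval. Only `x k` and its predecessor `x j` are affected, and a suitable weight
keeps one of them fixed. Hence `x k` may be moved towards `1 - x j`, or towards `1 - x l` for the
successor `l` (`IsCyclicTuple.mix`, `update_of_pred`, `update_of_succ`). Nested two-point laws
realise all coordinates but one, and these moves then adjust the last one whenever it lies between
`1 - x l` and `1 - x j`. So at a non-cyclic point of the cube the neighbour sums are all at most `1`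
or all at least `1` (`forall_add_le_or_forall_le_add`).

The two regions are exchanged by `x ↦ 1 - x`. The volume of the first is governed by the integral
operator with kernel `1_{s + t ≤ 1}` on `[0, 1]`, for which `cos (π t / 2)` is a positive
eigenfunction with eigenvalue `2 / π`; this gives the decay rate (`volume_isSmallChain_le`,
`volume_smallSums_le`).

For the upper bound on the probability, a variable with the largest median is at least its successor
with probability at least `1/4`. So some `x i ≤ 3/4`, by reflection some `x i ≥ 1/4`, and two corner
cubes of side `1/4` contain no cyclic tuple.

Measurability holds because the moves make the non-cyclic set upward closed within the large-sum
region and downward closed within the small-sum region (`IsCyclicTuple.anti`). -/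

/-! ### From random variables to laws on the line. -/

/-- The probability that a sample of `μ` is smaller than an independent sample of `ν`. -/
noncomputable def winProb (μ ν : Measure ℝ) : ℝ := (μ.prod ν).real {p | p.1 < p.2}

/-- The probability that independent samples of `μ` and `ν` coincide. -/
noncomputable def tieProb (μ ν : Measure ℝ) : ℝ := (μ.prod ν).real {p | p.1 = p.2}

/-- The laws `μ i` realise the tuple `x`. -/
structure Realises {n : ℕ} (μ : Fin n → Measure ℝ) (x : Fin n → ℝ) : Prop where
  isProb : ∀ i, IsProbabilityMeasure (μ i)
  tie : ∀ i j, i ≠ j → tieProb (μ i) (μ j) = 0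
  win : ∀ i, winProb (μ i) (μ (finRotate n i)) = x i

lemma measurableSet_fst_lt_snd : MeasurableSet {p : ℝ × ℝ | p.1 < p.2} :=
  measurableSet_lt measurable_fst measurable_snd

lemma measurableSet_fst_eq_snd : MeasurableSet {p : ℝ × ℝ | p.1 = p.2} :=
  measurableSet_eq_fun measurable_fst measurable_snd

lemma finRotate_ne_self {n : ℕ} (hn : 2 ≤ n) (i : Fin n) : finRotate n i ≠ i := by
  obtain ⟨m, rfl⟩ : ∃ m, n = m + 2 := ⟨n - 2, by omega⟩
  rw [finRotate_apply]
  simp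

lemma IsCyclicTuple.exists_realises {n : ℕ} (hn : 2 ≤ n) {x : Fin n → ℝ} (hx : IsCyclicTuple x) :
    ∃ μ, Realises μ x := by
  obtain ⟨-, Ω, _, P, U, hP, hU, hind, htie, hwin⟩ := hx
  have key : ∀ i j, i ≠ j → (P.map (U i)).prod (P.map (U j)) = P.map (fun ω => (U i ω, U j ω)) :=
    fun i j hij => ((indepFun_iff_map_prod_eq_prod_map_map (hU i).aemeasurable
      (hU j).aemeasurable).1 (hind.indepFun hij)).symm
  refine ⟨fun i => P.map (U i), fun i => Measure.isProbabilityMeasure_map (hU i).aemeasurable,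
    fun i j hij => ?_, fun i => ?_⟩
  · rw [tieProb, key i j hij, map_measureReal_apply ((hU i).prodMk (hU j))
      measurableSet_fst_eq_snd]
    simpa [Measure.real] using congrArg ENNReal.toReal (htie i j hij)
  · rw [winProb, key _ _ (finRotate_ne_self hn i).symm,
      map_measureReal_apply ((hU i).prodMk (hU _)) measurableSet_fst_lt_snd]
    exact hwin i

/-- The coordinate functions on the product space `Measure.pi μ` are independent with the prescribed
laws. -/
lemma Realises.isCyclicTuple {n : ℕ} (hn : 2 ≤ n) {μ : Fin n → Measure ℝ} {x : Fin n → ℝ}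
    (h : Realises μ x) : IsCyclicTuple x := by
  have := h.isProb
  have hind : iIndepFun (fun i (ω : Fin n → ℝ) => ω i) (Measure.pi μ) :=
    iIndepFun_pi (X := fun _ => id) fun i => aemeasurable_id
  have key : ∀ i j, i ≠ j →
      (Measure.pi μ).map (fun ω => (ω i, ω j)) = (μ i).prod (μ j) := fun i j hij => by
    have h1 := (indepFun_iff_map_prod_eq_prod_map_map (measurable_pi_apply i).aemeasurable
      (measurable_pi_apply j).aemeasurable).1 (hind.indepFun hij)
    have h2 : ∀ i, (Measure.pi μ).map (fun ω => ω i) = μ i :=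
      fun i => (measurePreserving_eval μ i).map_eq
    rw [h1, h2, h2]
  have hm : ∀ i j : Fin n, Measurable (fun ω : Fin n → ℝ => (ω i, ω j)) := fun i j =>
    (measurable_pi_apply i).prodMk (measurable_pi_apply j)
  refine ⟨fun i => ?_, Fin n → ℝ, inferInstance, Measure.pi μ, fun i ω => ω i, inferInstance,
    fun i => measurable_pi_apply i, hind, fun i j hij => ?_, fun i => ?_⟩
  · rw [← h.win i]
    exact ⟨measureReal_nonneg, measureReal_le_one⟩
  · have h1 := h.tie i j hij
    rw [tieProb, measureReal_eq_zero_iff, ← key i j hij,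
      Measure.map_apply (hm i j) measurableSet_fst_eq_snd] at h1
    exact h1
  · rw [← h.win i, winProb, ← key _ _ (finRotate_ne_self hn i).symm,
      map_measureReal_apply (hm _ _) measurableSet_fst_lt_snd]
    rfl

lemma winProb_map {f : ℝ → ℝ} (hf : StrictMono f) (hm : Measurable f) (μ ν : Measure ℝ)
    [IsProbabilityMeasure μ] [IsProbabilityMeasure ν] :
    winProb (μ.map f) (ν.map f) = winProb μ ν := by
  rw [winProb, winProb, Measure.map_prod_map _ _ hm hm,
    map_measureReal_apply (hm.prodMap hm) measurableSet_fst_lt_snd]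
  congr 1
  ext p
  simp [hf.lt_iff_lt]

lemma tieProb_map {f : ℝ → ℝ} (hf : Function.Injective f) (hm : Measurable f) (μ ν : Measure ℝ)
    [IsProbabilityMeasure μ] [IsProbabilityMeasure ν] :
    tieProb (μ.map f) (ν.map f) = tieProb μ ν := by
  rw [tieProb, tieProb, Measure.map_prod_map _ _ hm hm,
    map_measureReal_apply (hm.prodMap hm) measurableSet_fst_eq_snd]
  congr 1
  ext p
  simp [hf.eq_iff]

lemma tieProb_comm (μ ν : Measure ℝ) [IsProbabilityMeasure μ] [IsProbabilityMeasure ν] :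
    tieProb μ ν = tieProb ν μ := by
  rw [tieProb, tieProb, ← Measure.prod_swap,
    map_measureReal_apply measurable_swap measurableSet_fst_eq_snd]
  congr 1
  ext p
  simp [eq_comm]

lemma winProb_add_winProb (μ ν : Measure ℝ) [IsProbabilityMeasure μ] [IsProbabilityMeasure ν]
    (h : tieProb μ ν = 0) : winProb μ ν + winProb ν μ = 1 := by
  have h1 : winProb ν μ = (μ.prod ν).real {p | p.2 < p.1} := by
    rw [winProb, ← Measure.prod_swap, map_measureReal_apply measurable_swap
      measurableSet_fst_lt_snd]
    rfl
  have h2 : winProb ν μ = (μ.prod ν).real {p | p.1 < p.2}ᶜ := by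
    rw [h1]
    refine le_antisymm (measureReal_mono fun p hp => ?_) ?_
    · simp only [Set.mem_ofPred_eq, Set.mem_compl_iff] at hp ⊢
      linarith
    · calc (μ.prod ν).real {p | p.1 < p.2}ᶜ
          ≤ (μ.prod ν).real ({p | p.2 < p.1} ∪ {p | p.1 = p.2}) := by
            refine measureReal_mono fun p hp => ?_
            simp only [Set.mem_ofPred_eq, Set.mem_compl_iff, not_lt] at hp
            rcases hp.lt_or_eq with h | h
            · exact Or.inl h
            · exact Or.inr h.symm
        _ ≤ (μ.prod ν).real {p | p.2 < p.1} + (μ.prod ν).real {p | p.1 = p.2} :=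
            measureReal_union_le _ _
        _ = _ := by rw [show (μ.prod ν).real {p | p.1 = p.2} = 0 from h, add_zero]
  rw [h2, winProb]
  exact probReal_add_probReal_compl measurableSet_fst_lt_snd

/-! ### Two-point laws and mixtures. -/

/-- The law with mass `w` at `-a` and mass `1 - w` at `a`. -/
noncomputable def twoPoint (w a : ℝ) : Measure ℝ :=
  ENNReal.ofReal w • Measure.dirac (-a) + ENNReal.ofReal (1 - w) • Measure.dirac a

/-- The mixture of `μ` and `ν` with weights `1 - t` and `t`. -/
noncomputable def mixLaw (t : ℝ) (μ ν : Measure ℝ) : Measure ℝ :=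
  ENNReal.ofReal (1 - t) • μ + ENNReal.ofReal t • ν

lemma twoPoint_eq_mixLaw (w a : ℝ) :
    twoPoint w a = mixLaw (1 - w) (Measure.dirac (-a)) (Measure.dirac a) := by
  simp [twoPoint, mixLaw]

lemma isProbabilityMeasure_mixLaw {t : ℝ} (ht : t ∈ Set.Icc (0 : ℝ) 1) (μ ν : Measure ℝ)
    [IsProbabilityMeasure μ] [IsProbabilityMeasure ν] : IsProbabilityMeasure (mixLaw t μ ν) := by
  constructor
  simp only [mixLaw, Measure.coe_add, Measure.coe_smul, Pi.add_apply, Pi.smul_apply, measure_univ,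
    smul_eq_mul, mul_one]
  rw [← ENNReal.ofReal_add (by linarith [ht.2]) ht.1]
  simp

lemma prod_mixLaw_right {t : ℝ} (ht : t ∈ Set.Icc (0 : ℝ) 1) (ρ μ ν : Measure ℝ)
    [IsProbabilityMeasure ρ] [IsProbabilityMeasure μ] [IsProbabilityMeasure ν] (s : Set (ℝ × ℝ)) :
    (ρ.prod (mixLaw t μ ν)).real s = (1 - t) * (ρ.prod μ).real s + t * (ρ.prod ν).real s := by
  have h1 : 0 ≤ 1 - t := by linarith [ht.2]
  have i1 : SFinite (ENNReal.ofReal (1 - t) • μ) := inferInstance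
  have e : ρ.prod (mixLaw t μ ν) =
      ENNReal.ofReal (1 - t) • ρ.prod μ + ENNReal.ofReal t • ρ.prod ν := by
    rw [mixLaw, Measure.prod_add, Measure.prod_smul_right, Measure.prod_smul_right]
  simp only [e, Measure.real, Measure.coe_add, Measure.coe_smul, Pi.add_apply, Pi.smul_apply,
    smul_eq_mul]
  rw [ENNReal.toReal_add (by finiteness) (by finiteness), ENNReal.toReal_mul, ENNReal.toReal_mul,
    ENNReal.toReal_ofReal h1, ENNReal.toReal_ofReal ht.1]

lemma prod_mixLaw_left {t : ℝ} (ht : t ∈ Set.Icc (0 : ℝ) 1) (ρ μ ν : Measure ℝ)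
    [IsProbabilityMeasure ρ] [IsProbabilityMeasure μ] [IsProbabilityMeasure ν] (s : Set (ℝ × ℝ)) :
    ((mixLaw t μ ν).prod ρ).real s = (1 - t) * (μ.prod ρ).real s + t * (ν.prod ρ).real s := by
  have h1 : 0 ≤ 1 - t := by linarith [ht.2]
  have e : (mixLaw t μ ν).prod ρ =
      ENNReal.ofReal (1 - t) • μ.prod ρ + ENNReal.ofReal t • ν.prod ρ := by
    rw [mixLaw, Measure.add_prod, Measure.prod_smul_left, Measure.prod_smul_left]
  simp only [e, Measure.real, Measure.coe_add, Measure.coe_smul, Pi.add_apply, Pi.smul_apply,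
    smul_eq_mul]
  rw [ENNReal.toReal_add (by finiteness) (by finiteness), ENNReal.toReal_mul, ENNReal.toReal_mul,
    ENNReal.toReal_ofReal h1, ENNReal.toReal_ofReal ht.1]

lemma isProbabilityMeasure_twoPoint {w : ℝ} (hw : w ∈ Set.Icc (0 : ℝ) 1) (a : ℝ) :
    IsProbabilityMeasure (twoPoint w a) := by
  rw [twoPoint_eq_mixLaw]
  exact isProbabilityMeasure_mixLaw ⟨by linarith [hw.2], by linarith [hw.1]⟩ _ _

/-- A law is concentrated on `(-a, a)`. -/
def Within (ρ : Measure ℝ) (a : ℝ) : Prop := ∀ᵐ u ∂ρ, u ∈ Set.Ioo (-a) a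

lemma real_dirac_prod (ρ : Measure ℝ) [IsProbabilityMeasure ρ] (c : ℝ) {s : Set (ℝ × ℝ)}
    (hs : MeasurableSet s) : ((Measure.dirac c).prod ρ).real s = ρ.real {u | (c, u) ∈ s} := by
  rw [Measure.dirac_prod, map_measureReal_apply measurable_prodMk_left hs]
  rfl

lemma real_eq_one_of_ae (ρ : Measure ℝ) [IsProbabilityMeasure ρ] {s : Set ℝ}
    (h : ∀ᵐ u ∂ρ, u ∈ s) : ρ.real s = 1 := by
  rw [Measure.real, (prob_compl_eq_zero_iff₀ (s := s) ?_).1 (mem_ae_iff.1 h)]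
  · simp
  · exact NullMeasurableSet.of_compl (NullMeasurableSet.of_null (mem_ae_iff.1 h))

lemma real_eq_zero_of_ae (ρ : Measure ℝ) {s : Set ℝ} (h : ∀ᵐ u ∂ρ, u ∉ s) : ρ.real s = 0 := by
  rw [Measure.real, measure_eq_zero_iff_ae_notMem.2 h, ENNReal.toReal_zero]

/-- Only the sign of the outer sample matters: `-a` lies below every value of `ρ` and `a` above,
whatever `ρ` is. -/
lemma winProb_twoPoint_left {w : ℝ} (hw : w ∈ Set.Icc (0 : ℝ) 1) {a : ℝ} {ρ : Measure ℝ}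
    [IsProbabilityMeasure ρ] (h : Within ρ a) : winProb (twoPoint w a) ρ = w := by
  rw [twoPoint_eq_mixLaw, winProb, prod_mixLaw_left ⟨by linarith [hw.2], by linarith [hw.1]⟩,
    real_dirac_prod _ _ measurableSet_fst_lt_snd, real_dirac_prod _ _ measurableSet_fst_lt_snd,
    real_eq_one_of_ae, real_eq_zero_of_ae]
  · ring
  · filter_upwards [h] with u hu
    simpa using hu.2.le
  · filter_upwards [h] with u hu
    simpa using hu.1

lemma tieProb_twoPoint_left {w : ℝ} (hw : w ∈ Set.Icc (0 : ℝ) 1) {a : ℝ} {ρ : Measure ℝ}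
    [IsProbabilityMeasure ρ] (h : Within ρ a) : tieProb (twoPoint w a) ρ = 0 := by
  rw [twoPoint_eq_mixLaw, tieProb, prod_mixLaw_left ⟨by linarith [hw.2], by linarith [hw.1]⟩,
    real_dirac_prod _ _ measurableSet_fst_eq_snd, real_dirac_prod _ _ measurableSet_fst_eq_snd,
    real_eq_zero_of_ae, real_eq_zero_of_ae]
  · ring
  · filter_upwards [h] with u hu
    simpa using hu.2.ne'
  · filter_upwards [h] with u hu
    simpa using hu.1.ne

lemma winProb_twoPoint_right {w : ℝ} (hw : w ∈ Set.Icc (0 : ℝ) 1) {a : ℝ} {ρ : Measure ℝ}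
    [IsProbabilityMeasure ρ] (h : Within ρ a) : winProb ρ (twoPoint w a) = 1 - w := by
  have := isProbabilityMeasure_twoPoint hw a
  have h1 := winProb_add_winProb _ _ (tieProb_twoPoint_left hw h)
  rw [winProb_twoPoint_left hw h] at h1
  linarith

lemma within_twoPoint (w : ℝ) {a b : ℝ} (ha : 0 < a) (hab : a < b) :
    Within (twoPoint w a) b := by
  have h : ∀ c : ℝ, c ∈ Set.Ioo (-b) b → ∀ r : ENNReal,
      ∀ᵐ u ∂(r • Measure.dirac c), u ∈ Set.Ioo (-b) b := fun c hc r =>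
    Measure.ae_smul_measure ((ae_dirac_iff measurableSet_Ioo).2 hc) r
  rw [Within, twoPoint, ae_add_measure_iff]
  exact ⟨h _ ⟨by linarith, by linarith⟩ _, h _ ⟨by linarith, hab⟩ _⟩

/-! ### Moves that preserve cyclicity. -/

/-- Laws realising a cyclic tuple can be squeezed into a bounded interval. -/
lemma Realises.exists_within {n : ℕ} {μ : Fin n → Measure ℝ} {x : Fin n → ℝ} (h : Realises μ x) :
    ∃ μ' : Fin n → Measure ℝ, Realises μ' x ∧ ∀ i, Within (μ' i) 2 := by
  have := h.isProb
  have hm : Measurable Real.arctan := Real.continuous_arctan.measurable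
  refine ⟨fun i => (μ i).map Real.arctan,
    ⟨fun i => Measure.isProbabilityMeasure_map hm.aemeasurable, fun i j hij => ?_, fun i => ?_⟩,
    fun i => ?_⟩
  · rw [tieProb_map Real.arctan_injective hm, h.tie i j hij]
  · rw [winProb_map Real.arctan_strictMono hm, h.win i]
  · refine (ae_map_iff hm.aemeasurable measurableSet_Ioo).2 ?_
    refine Eventually.of_forall fun u => ⟨?_, ?_⟩
    · linarith [Real.neg_pi_div_two_lt_arctan u, Real.pi_lt_four]
    · linarith [Real.arctan_lt_pi_div_two u, Real.pi_lt_four]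

/-- Mixing the law of index `k` with a law concentrated outside the range of the others. -/
lemma IsCyclicTuple.mix {n : ℕ} (hn : 2 ≤ n) {x : Fin n → ℝ} (hx : IsCyclicTuple x) {j k : Fin n}
    (hjk : finRotate n j = k) {t w : ℝ} (ht : t ∈ Set.Icc (0 : ℝ) 1)
    (hw : w ∈ Set.Icc (0 : ℝ) 1) :
    IsCyclicTuple (Function.update (Function.update x k ((1 - t) * x k + t * w)) j
      ((1 - t) * x j + t * (1 - w))) := by
  obtain ⟨μ₀, h₀⟩ := hx.exists_realises hn
  obtain ⟨μ, h, hμ⟩ := h₀.exists_within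
  have := h.isProb
  have i1 := isProbabilityMeasure_twoPoint hw 2
  have i2 := isProbabilityMeasure_mixLaw ht (μ k) (twoPoint w 2)
  have hne : j ≠ k := fun e => finRotate_ne_self hn j (hjk.trans e.symm)
  have htie : ∀ i, i ≠ k → tieProb (mixLaw t (μ k) (twoPoint w 2)) (μ i) = 0 := fun i hi => by
    rw [tieProb, prod_mixLaw_left ht]
    have h1 := h.tie k i hi.symm
    have h2 := tieProb_twoPoint_left hw (hμ i)
    rw [tieProb] at h1 h2
    rw [h1, h2]
    ring
  -- Only the law of index `k` changes, so only the coordinates `k` and `j` move. The mixed-in law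
  -- lives at `±2`, outside the range of all the others, so it creates no ties and contributes `w`
  -- at `k` and `1 - w` at `j`.
  refine Realises.isCyclicTuple hn
    (μ := Function.update μ k (mixLaw t (μ k) (twoPoint w 2))) ⟨fun i => ?_, fun i l hil => ?_,
      fun i => ?_⟩
  · rcases eq_or_ne i k with rfl | hi
    · simpa using i2
    · simpa [hi] using h.isProb i
  · rcases eq_or_ne i k with rfl | hi
    · simpa [hil.symm] using htie l hil.symm
    · rcases eq_or_ne l k with rfl | hl
      · rw [Function.update_self, Function.update_of_ne hi, tieProb_comm]
        exact htie i hi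
      · simpa [hi, hl] using h.tie i l hil
  · rcases eq_or_ne i k with rfl | hi
    · have h1 := h.win i
      have h2 := winProb_twoPoint_left hw (hμ (finRotate n i))
      rw [winProb] at h1 h2
      rw [Function.update_self, Function.update_of_ne (finRotate_ne_self hn i),
        Function.update_of_ne hne.symm, Function.update_self, winProb, prod_mixLaw_left ht, h1, h2]
    · rcases eq_or_ne i j with rfl | hj
      · have h1 := h.win i
        have h2 := winProb_twoPoint_right hw (hμ i)
        rw [winProb] at h1 h2
        rw [hjk] at h1 ⊢
        rw [Function.update_self, Function.update_of_ne hi, Function.update_self, winProb,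
          prod_mixLaw_right ht, h1, h2]
      · have hr : finRotate n i ≠ k := fun e => hj ((finRotate n).injective (e.trans hjk.symm))
        rw [Function.update_of_ne hj, Function.update_of_ne hi, Function.update_of_ne hi,
          Function.update_of_ne hr, h.win i]

lemma exists_convex_weight {a b s : ℝ} (hs : s ∈ Set.uIcc a b) :
    ∃ t ∈ Set.Icc (0 : ℝ) 1, s = (1 - t) * a + t * b := by
  rw [← segment_eq_uIcc, segment_eq_image] at hs
  obtain ⟨t, ht, rfl⟩ := hs
  exact ⟨t, ht, by simp⟩

/-- The weight `w = 1 - x j` makes the mixture leave `x j` unchanged. -/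
lemma IsCyclicTuple.update_of_pred {n : ℕ} (hn : 2 ≤ n) {x : Fin n → ℝ} (hx : IsCyclicTuple x)
    {j k : Fin n} (hjk : finRotate n j = k) {s : ℝ} (hs : s ∈ Set.uIcc (x k) (1 - x j)) :
    IsCyclicTuple (Function.update x k s) := by
  obtain ⟨t, ht, rfl⟩ := exists_convex_weight hs
  have hj := hx.1 j
  have hne : j ≠ k := fun e => finRotate_ne_self hn j (hjk.trans e.symm)
  convert hx.mix hn hjk ht (w := 1 - x j) ⟨by linarith [hj.2], by linarith [hj.1]⟩ using 1
  rw [eq_comm, Function.update_eq_self_iff, Function.update_of_ne hne]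
  ring

/-- Here the law of the successor `l` is mixed, with weight `w = x l`, so that `x l` is unchanged
and its predecessor `x k` moves. -/
lemma IsCyclicTuple.update_of_succ {n : ℕ} (hn : 2 ≤ n) {x : Fin n → ℝ} (hx : IsCyclicTuple x)
    {k l : Fin n} (hkl : finRotate n k = l) {s : ℝ} (hs : s ∈ Set.uIcc (x k) (1 - x l)) :
    IsCyclicTuple (Function.update x k s) := by
  obtain ⟨t, ht, rfl⟩ := exists_convex_weight hs
  have hne : k ≠ l := fun e => finRotate_ne_self hn k (hkl.trans e.symm)
  convert hx.mix hn hkl ht (hx.1 l) using 2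
  rw [eq_comm, Function.update_eq_self_iff]
  ring

/-- Without the constraint at one index, every point of the cube can be realised. -/
lemma exists_isCyclicTuple_update {n : ℕ} (hn : 2 ≤ n) {x : Fin n → ℝ}
    (hx : ∀ i, x i ∈ Set.Icc (0 : ℝ) 1) (k : Fin n) :
    ∃ t, IsCyclicTuple (Function.update x k t) := by
  obtain ⟨m, rfl⟩ : ∃ m, n = m + 1 := ⟨n - 1, by omega⟩
  -- Radii that decrease along the cycle from `k + 1` round to `k`, where the radius is `1`. Each
  -- law except that of `k` encloses its successor, so its win probability is its own weight `x i`.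
  let a : Fin (m + 1) → ℝ := fun i => (k - i : Fin (m + 1)).val + 1
  have ha : ∀ i, 0 < a i := fun i => by positivity
  have ha_inj : Function.Injective a := fun i j hij => by
    simpa [a, Fin.val_inj] using hij
  have ha_lt : ∀ i, i ≠ k → a (finRotate _ i) < a i := fun i hi => by
    have h0 : k - i ≠ 0 := sub_ne_zero.2 hi.symm
    have h1 : k - (i + 1) = k - i - 1 := by abel
    have h2 : (k - i - 1).val < (k - i).val := by
      rw [Fin.val_sub_one_of_ne_zero h0]
      have : (k - i).val ≠ 0 := fun e => h0 (Fin.ext e)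
      omega
    simp only [a, finRotate_apply, h1]
    exact_mod_cast Nat.add_lt_add_right h2 1
  have hp := fun i => isProbabilityMeasure_twoPoint (hx i) (a i)
  refine ⟨winProb (twoPoint (x k) (a k)) (twoPoint (x (finRotate _ k)) (a (finRotate _ k))),
    Realises.isCyclicTuple hn (μ := fun i => twoPoint (x i) (a i)) ⟨hp, fun i j hij => ?_,
      fun i => ?_⟩⟩
  · rcases lt_or_gt_of_ne (ha_inj.ne hij) with h | h
    · rw [tieProb_comm]
      exact tieProb_twoPoint_left (hx j) (within_twoPoint _ (ha i) h)
    · exact tieProb_twoPoint_left (hx i) (within_twoPoint _ (ha j) h)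
  · rcases eq_or_ne i k with rfl | hi
    · rw [Function.update_self]
    · rw [Function.update_of_ne hi]
      exact winProb_twoPoint_left (hx i) (within_twoPoint _ (ha _) (ha_lt i hi))

/-- Negating all variables reverses every comparison, and there are no ties. -/
lemma IsCyclicTuple.reflect {n : ℕ} (hn : 2 ≤ n) {x : Fin n → ℝ} (hx : IsCyclicTuple x) :
    IsCyclicTuple (1 - x) := by
  obtain ⟨μ, h⟩ := hx.exists_realises hn
  have := h.isProb
  have hm : Measurable (fun u : ℝ => -u) := measurable_neg
  refine Realises.isCyclicTuple hn (μ := fun i => (μ i).map (fun u => -u))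
    ⟨fun i => Measure.isProbabilityMeasure_map hm.aemeasurable, fun i j hij => ?_, fun i => ?_⟩
  · rw [tieProb_map neg_injective hm, h.tie i j hij]
  · have h1 := winProb_add_winProb _ _ (h.tie _ _ (finRotate_ne_self hn i).symm)
    have h2 : winProb ((μ i).map fun u => -u) ((μ (finRotate n i)).map fun u => -u) =
        winProb (μ (finRotate n i)) (μ i) := by
      rw [winProb, winProb, Measure.map_prod_map _ _ hm hm,
        map_measureReal_apply (hm.prodMap hm) measurableSet_fst_lt_snd, ← Measure.prod_swap,
        map_measureReal_apply measurable_swap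
          ((hm.prodMap hm) measurableSet_fst_lt_snd)]
      congr 1
      ext p
      simp
    rw [h2, Pi.sub_apply, Pi.one_apply, ← h.win i]
    linarith

/-! ### Neighbour sums of non-cyclic tuples. -/

/-- A tuple of the cube is cyclic if two consecutive sums of neighbours lie on different sides
of `1`. -/
lemma isCyclicTuple_of_add_le_of_le_add {n : ℕ} (hn : 2 ≤ n) {x : Fin n → ℝ}
    (hx : ∀ i, x i ∈ Set.Icc (0 : ℝ) 1) {j k l : Fin n} (hjk : finRotate n j = k)
    (hkl : finRotate n k = l) (h1 : x j + x k ≤ 1) (h2 : 1 ≤ x k + x l) : IsCyclicTuple x := by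
  obtain ⟨t, ht⟩ := exists_isCyclicTuple_update hn hx k
  have hj : j ≠ k := fun e => finRotate_ne_self hn j (hjk.trans e.symm)
  have hl : l ≠ k := fun e => finRotate_ne_self hn k (hkl.trans e)
  -- The uncontrolled value `t` is first moved all the way to `1 - x j`. The hypotheses place `x k`
  -- between `1 - x l` and `1 - x j`, so the second move reaches it.
  have h3 := ht.update_of_pred hn hjk (s := 1 - x j) (by
    rw [Function.update_of_ne hj]; exact Set.right_mem_uIcc)
  have h4 := h3.update_of_succ hn hkl (s := x k) (by
    rw [Function.update_self, Function.update_of_ne hl, Function.update_of_ne hl]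
    exact Set.mem_uIcc.2 (Or.inr ⟨by linarith, by linarith⟩))
  simpa using h4

lemma forall_of_finRotate {n : ℕ} {p : Fin n → Prop} {j : Fin n} (hj : p j)
    (h : ∀ i, p i → p (finRotate n i)) (i : Fin n) : p i := by
  obtain ⟨m, rfl⟩ : ∃ m, n = m + 1 := ⟨n - 1, by have := i.2; omega⟩
  have key : ∀ r : ℕ, p (j + Fin.ofNat (m + 1) r) := fun r => by
    induction r with
    | zero => simpa using hj
    | succ r ih =>
      have := h _ ih
      rw [finRotate_apply, add_assoc] at this
      convert this using 2
      exact Fin.ext (by simp [Fin.val_add])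
  have := key (i - j).val
  simpa using this

lemma forall_add_le_or_forall_le_add {n : ℕ} (hn : 2 ≤ n) {x : Fin n → ℝ}
    (hx : ∀ i, x i ∈ Set.Icc (0 : ℝ) 1) (hc : ¬ IsCyclicTuple x) :
    (∀ i, x i + x (finRotate n i) ≤ 1) ∨ ∀ i, 1 ≤ x i + x (finRotate n i) := by
  by_cases h : ∃ j, x j + x (finRotate n j) ≤ 1
  · obtain ⟨j, hj⟩ := h
    refine Or.inl (forall_of_finRotate hj fun i hi => ?_)
    by_contra h2
    exact hc (isCyclicTuple_of_add_le_of_le_add hn hx rfl rfl hi (not_le.1 h2).le)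
  · push Not at h
    exact Or.inr fun i => (h i).le

/-- The coordinates are lowered from `x` to `z` one at a time. At each stage the current value at
the predecessor `j` is at least `z j ≥ 1 - z k`, so `z k` lies between `1` minus that value and `x
k`, within reach of `update_of_pred`. -/
lemma IsCyclicTuple.anti {n : ℕ} (hn : 2 ≤ n) {x z : Fin n → ℝ} (hx : IsCyclicTuple x)
    (hzx : z ≤ x) (hz : ∀ i, 1 ≤ z i + z (finRotate n i)) : IsCyclicTuple z := by
  have key : ∀ S : Finset (Fin n), IsCyclicTuple (fun i => if i ∈ S then z i else x i) := by
    intro S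
    induction S using Finset.induction_on with
    | empty => simpa using hx
    | insert k S hk ih =>
      obtain ⟨j, hj⟩ := (finRotate n).surjective k
      have h1 := hz j
      have h2 := hzx j
      have h3 := hzx k
      rw [hj] at h1
      have h4 := ih.update_of_pred hn hj (s := z k) (by
        rw [if_neg hk]
        refine Set.mem_uIcc.2 (Or.inr ⟨?_, h3⟩)
        split_ifs <;> linarith)
      convert h4 using 1
      ext i
      rcases eq_or_ne i k with rfl | hi
      · simp
      · simp [hi]
  simpa using key Finset.univ

/-! ### The two regions of the cube, and measurability. -/

/-- The unit cube. -/
def unitCube (n : ℕ) : Set (Fin n → ℝ) := Set.Icc 0 1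

lemma mem_unitCube {n : ℕ} {x : Fin n → ℝ} :
    x ∈ unitCube n ↔ ∀ i, x i ∈ Set.Icc (0 : ℝ) 1 := by
  simp only [unitCube, Set.mem_Icc, Pi.le_def, Pi.zero_apply, Pi.one_apply, forall_and]

lemma cyclicTuples_subset_unitCube (n : ℕ) : cyclicTuples n ⊆ unitCube n :=
  fun _ hx => mem_unitCube.2 hx.1

/-- The points of the cube all of whose sums of neighbours are at most `1`. -/
def smallSums (n : ℕ) : Set (Fin n → ℝ) :=
  {x | x ∈ unitCube n ∧ ∀ i, x i + x (finRotate n i) ≤ 1}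

/-- The points of the cube all of whose sums of neighbours are at least `1`. -/
def largeSums (n : ℕ) : Set (Fin n → ℝ) :=
  {x | x ∈ unitCube n ∧ ∀ i, 1 ≤ x i + x (finRotate n i)}

lemma one_sub_mem_unitCube {n : ℕ} {x : Fin n → ℝ} (hx : x ∈ unitCube n) :
    1 - x ∈ unitCube n := by
  rw [mem_unitCube] at *
  exact fun i => ⟨by simpa using (hx i).2, by simpa using (hx i).1⟩

lemma one_sub_mem_largeSums {n : ℕ} {x : Fin n → ℝ} (hx : x ∈ smallSums n) :
    1 - x ∈ largeSums n :=
  ⟨one_sub_mem_unitCube hx.1, fun i => by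
    have := hx.2 i
    simp only [Pi.sub_apply, Pi.one_apply]
    linarith⟩

lemma one_sub_mem_smallSums {n : ℕ} {x : Fin n → ℝ} (hx : x ∈ largeSums n) :
    1 - x ∈ smallSums n :=
  ⟨one_sub_mem_unitCube hx.1, fun i => by
    have := hx.2 i
    simp only [Pi.sub_apply, Pi.one_apply]
    linarith⟩

lemma one_sub_mem_cyclicTuples_iff {n : ℕ} (hn : 2 ≤ n) {x : Fin n → ℝ} :
    1 - x ∈ cyclicTuples n ↔ x ∈ cyclicTuples n :=
  ⟨fun h => by simpa [cyclicTuples] using IsCyclicTuple.reflect hn h, fun h => IsCyclicTuple.reflect hn h⟩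

lemma unitCube_diff_cyclicTuples_subset {n : ℕ} (hn : 2 ≤ n) :
    unitCube n \ cyclicTuples n ⊆ smallSums n ∪ largeSums n := fun _ hx =>
  (forall_add_le_or_forall_le_add hn (mem_unitCube.1 hx.1) hx.2).imp
    (fun h => ⟨hx.1, h⟩) (fun h => ⟨hx.1, h⟩)

lemma isCyclicTuple_of_le_of_mem_largeSums {n : ℕ} (hn : 2 ≤ n) {x z : Fin n → ℝ}
    (hx : x ∈ cyclicTuples n) (hz : z ∈ largeSums n) (hzx : z ≤ x) : z ∈ cyclicTuples n :=
  IsCyclicTuple.anti hn hx hzx hz.2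

lemma isCyclicTuple_of_le_of_mem_smallSums {n : ℕ} (hn : 2 ≤ n) {x z : Fin n → ℝ}
    (hx : x ∈ cyclicTuples n) (hz : z ∈ smallSums n) (hxz : x ≤ z) : z ∈ cyclicTuples n :=
  (one_sub_mem_cyclicTuples_iff hn).1 <|
    isCyclicTuple_of_le_of_mem_largeSums hn ((one_sub_mem_cyclicTuples_iff hn).2 hx)
      (one_sub_mem_largeSums hz) (sub_le_sub_left hxz 1)

/-- The non-cyclic points of the cube are cut out by an upper set and a lower set. -/
lemma nullMeasurableSet_cyclicTuples {n : ℕ} (hn : 2 ≤ n) :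
    NullMeasurableSet (cyclicTuples n) (volume : Measure (Fin n → ℝ)) := by
  let S := upperClosure (largeSums n \ cyclicTuples n)
  let T := lowerClosure (smallSums n \ cyclicTuples n)
  have h : cyclicTuples n = unitCube n \ (S ∪ T : Set (Fin n → ℝ)) := by
    ext x
    constructor
    · refine fun hx => ⟨cyclicTuples_subset_unitCube n hx, ?_⟩
      rintro (⟨z, hz, hzx⟩ | ⟨z, hz, hxz⟩)
      · exact hz.2 (isCyclicTuple_of_le_of_mem_largeSums hn hx hz.1 hzx)
      · exact hz.2 (isCyclicTuple_of_le_of_mem_smallSums hn hx hz.1 hxz)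
    · rintro ⟨hx, hST⟩
      by_contra hc
      refine hST ?_
      rcases unitCube_diff_cyclicTuples_subset hn ⟨hx, hc⟩ with h | h
      · exact Or.inr ⟨x, ⟨h, hc⟩, le_rfl⟩
      · exact Or.inl ⟨x, ⟨h, hc⟩, le_rfl⟩
  rw [h]
  -- Upper and lower sets are order-connected, and order-connected sets in `ℝⁿ` are null measurable.
  exact measurableSet_Icc.nullMeasurableSet.diff
    (S.upper.ordConnected.nullMeasurableSet.union T.lower.ordConnected.nullMeasurableSet)

/-! ### Medians and the corner cubes. -/

/-- The median is the infimum of the points where the cdf is at least `1/2`. Right continuity gives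
the first bound, the left limit the second. -/
lemma exists_median (μ : Measure ℝ) [IsProbabilityMeasure μ] :
    ∃ m, 1 / 2 ≤ μ.real (Set.Iic m) ∧ 1 / 2 ≤ μ.real (Set.Ici m) := by
  set S : Set ℝ := {t | 1 / 2 ≤ cdf μ t} with hS
  have hne : S.Nonempty :=
    ((tendsto_cdf_atTop μ).eventually (eventually_ge_nhds (by norm_num))).exists
  have hbdd : BddBelow S := by
    obtain ⟨b, hb⟩ :=
      ((tendsto_cdf_atBot μ).eventually (eventually_lt_nhds (by norm_num : (0 : ℝ) < 1 / 2))).exists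
    refine ⟨b, fun t ht => ?_⟩
    by_contra hlt
    have := monotone_cdf μ (not_le.1 hlt).le
    have ht' : 1 / 2 ≤ cdf μ t := ht
    linarith
  have hlt : ∀ t, t < sInf S → cdf μ t < 1 / 2 := fun t ht =>
    not_le.1 fun h => (notMem_of_lt_csInf ht hbdd) h
  have hgt : ∀ t, sInf S < t → 1 / 2 ≤ cdf μ t := fun t ht => by
    obtain ⟨s, hs, hst⟩ := exists_lt_of_csInf_lt hne ht
    exact le_trans hs (monotone_cdf μ hst.le)
  refine ⟨sInf S, ?_, ?_⟩
  · rw [← cdf_eq_real]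
    refine ge_of_tendsto (((cdf μ).right_continuous (sInf S)).mono Set.Ioi_subset_Ici_self) ?_
    filter_upwards [self_mem_nhdsWithin] with t ht using hgt t ht
  · have h1 : μ (Set.Iio (sInf S)) = ENNReal.ofReal (Function.leftLim (cdf μ) (sInf S) - 0) := by
      conv_lhs => rw [← measure_cdf μ]
      exact (cdf μ).measure_Iio (tendsto_cdf_atBot μ) _
    have h2 : Function.leftLim (cdf μ) (sInf S) ≤ 1 / 2 := by
      refine le_of_tendsto ((monotone_cdf μ).tendsto_leftLim (sInf S)) ?_
      filter_upwards [self_mem_nhdsWithin] with t ht using (hlt t ht).le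
    have h3 : μ.real (Set.Iio (sInf S)) ≤ 1 / 2 := by
      rw [Measure.real, h1]
      exact ENNReal.toReal_le_of_le_ofReal (by norm_num) (ENNReal.ofReal_le_ofReal (by linarith))
    have h4 := probReal_add_probReal_compl (μ := μ) (measurableSet_Iio (a := sInf S))
    rw [Set.compl_Iio] at h4
    linarith

/-- Medians cannot increase strictly all the way round the cycle. Where `m (i + 1) ≤ m i`,
independence gives `P(U (i + 1) ≤ U i) ≥ 1/2 · 1/2`. -/
lemma IsCyclicTuple.exists_le {n : ℕ} (hn : 2 ≤ n) {x : Fin n → ℝ} (hx : IsCyclicTuple x) :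
    ∃ i, x i ≤ 3 / 4 := by
  obtain ⟨μ, h⟩ := hx.exists_realises hn
  have := h.isProb
  choose m hm1 hm2 using fun i => exists_median (μ i)
  obtain ⟨i, hi⟩ : ∃ i, m (finRotate n i) ≤ m i := by
    have : Nonempty (Fin n) := ⟨⟨0, by omega⟩⟩
    obtain ⟨i, hi⟩ := Finite.exists_max m
    exact ⟨i, hi _⟩
  refine ⟨i, ?_⟩
  have h1 := probReal_add_probReal_compl (μ := (μ i).prod (μ (finRotate n i)))
    measurableSet_fst_lt_snd
  have h2 : (μ i).real (Set.Ici (m i)) * (μ (finRotate n i)).real (Set.Iic (m (finRotate n i))) ≤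
      ((μ i).prod (μ (finRotate n i))).real {p | p.1 < p.2}ᶜ := by
    rw [← measureReal_prod_prod]
    refine measureReal_mono fun p hp => ?_
    have hp1 : m i ≤ p.1 := hp.1
    have hp2 : p.2 ≤ m (finRotate n i) := hp.2
    simp only [Set.mem_compl_iff, Set.mem_ofPred_eq, not_lt]
    linarith
  have h3 := mul_le_mul (hm2 i) (hm1 (finRotate n i)) (by norm_num) measureReal_nonneg
  rw [← h.win i, winProb]
  linarith

lemma IsCyclicTuple.exists_ge {n : ℕ} (hn : 2 ≤ n) {x : Fin n → ℝ} (hx : IsCyclicTuple x) :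
    ∃ i, 1 / 4 ≤ x i := by
  obtain ⟨i, hi⟩ := (hx.reflect hn).exists_le hn
  exact ⟨i, by simp only [Pi.sub_apply, Pi.one_apply] at hi; linarith⟩

/-! ### Volume of the small-sum region. -/

/-- The nonnegative chains `x` of length `m` such that all sums of neighbours in the sequence
`a, x 0, …, x (m - 1), b` are at most `1`. -/
def IsSmallChain : (m : ℕ) → ℝ → (Fin m → ℝ) → ℝ → Prop
  | 0, a, _, b => a + b ≤ 1
  | m + 1, a, x, b => 0 ≤ x 0 ∧ a + x 0 ≤ 1 ∧ IsSmallChain m (x 0) (Fin.tail x) b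

lemma measurable_finTail (m : ℕ) : Measurable (Fin.tail : (Fin (m + 1) → ℝ) → Fin m → ℝ) :=
  measurable_pi_lambda _ fun i => measurable_pi_apply i.succ

lemma measurableSet_isSmallChain (m : ℕ) :
    MeasurableSet {p : ℝ × (Fin m → ℝ) × ℝ | IsSmallChain m p.1 p.2.1 p.2.2} := by
  induction m with
  | zero =>
    exact measurableSet_le (measurable_fst.add (measurable_snd.comp measurable_snd))
      measurable_const
  | succ m ih =>
    have h0 : Measurable fun p : ℝ × (Fin (m + 1) → ℝ) × ℝ => p.2.1 0 := by fun_prop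
    have h1 : Measurable fun p : ℝ × (Fin (m + 1) → ℝ) × ℝ =>
        (p.2.1 0, Fin.tail p.2.1, p.2.2) :=
      h0.prodMk (((measurable_finTail m).comp (measurable_fst.comp measurable_snd)).prodMk
        (measurable_snd.comp measurable_snd))
    exact (measurableSet_le measurable_const h0).inter
      ((measurableSet_le (measurable_fst.add h0) measurable_const).inter (h1 ih))

/-- Passes from the recursive definition to indexed inequalities: `cons a x` and `snoc x b` list the
left and right members of the neighbouring pairs. When both ends are `x 0`, they become a tuple and
its rotation. -/
lemma isSmallChain_of_forall {m : ℕ} {a b : ℝ} {x : Fin m → ℝ} (h0 : ∀ i, 0 ≤ x i)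
    (h : ∀ i, (Fin.cons a x : Fin (m + 1) → ℝ) i + (Fin.snoc x b : Fin (m + 1) → ℝ) i ≤ 1) :
    IsSmallChain m a x b := by
  induction m generalizing a with
  | zero =>
    have h1 := h (Fin.last 0)
    rw [Fin.snoc_last] at h1
    exact h1
  | succ m ih =>
    refine ⟨h0 0, ?_, ih (fun i => h0 i.succ) fun i => ?_⟩
    · simpa using h 0
    · have h1 := h i.succ
      rw [← Fin.cons_self_tail x, ← Fin.cons_snoc_eq_snoc_cons, Fin.cons_succ, Fin.cons_succ,
        Fin.cons_self_tail] at h1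
      rw [Fin.cons_self_tail]
      exact h1

lemma volume_eq_lintegral_cons {m : ℕ} {s : Set (Fin (m + 1) → ℝ)} (hs : MeasurableSet s) :
    volume s = ∫⁻ t : ℝ, volume {y : Fin m → ℝ | (Fin.cons t y : Fin (m + 1) → ℝ) ∈ s} := by
  have h := (volume_preserving_piFinSuccAbove (fun _ : Fin (m + 1) => ℝ) 0).symm
  rw [← h.measure_preimage_equiv, Measure.volume_eq_prod,
    Measure.prod_apply ((MeasurableEquiv.measurable _) hs)]
  refine lintegral_congr fun t => congrArg _ (Set.ext fun y => ?_)
  simp [MeasurableEquiv.piFinSuccAbove, Fin.insertNthEquiv, Fin.insertNth_zero']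

lemma measurableSet_isSmallChain_left {m : ℕ} (a b : ℝ) :
    MeasurableSet {x : Fin m → ℝ | IsSmallChain m a x b} :=
  (measurable_const.prodMk (measurable_id.prodMk measurable_const) :
    Measurable fun x : Fin m → ℝ => (a, x, b)) (measurableSet_isSmallChain m)

lemma volume_isSmallChain_succ (m : ℕ) (a b : ℝ) :
    volume {x : Fin (m + 1) → ℝ | IsSmallChain (m + 1) a x b} =
      ∫⁻ t in Set.Icc 0 (1 - a), volume {x : Fin m → ℝ | IsSmallChain m t x b} := by
  rw [volume_eq_lintegral_cons (measurableSet_isSmallChain_left a b),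
    ← lintegral_indicator measurableSet_Icc]
  congr 1
  ext t
  by_cases ht : t ∈ Set.Icc 0 (1 - a)
  · rw [Set.indicator_of_mem ht]
    congr 1
    ext y
    have h1 : a + t ≤ 1 := by linarith [ht.2]
    simp [IsSmallChain, ht.1, h1]
  · rw [Set.indicator_of_notMem ht]
    convert measure_empty (μ := (volume : Measure (Fin m → ℝ)))
    ext y
    simp only [IsSmallChain, Fin.cons_zero, Set.mem_ofPred_eq, Set.mem_empty_iff_false, iff_false]
    exact fun h => ht ⟨h.1, by linarith [h.2.1]⟩

/-- The main estimate behind the comparison of the kernel `min (1 - a) (1 - b)` with the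
eigenfunction `a ↦ cos (π a / 2)`. -/
lemma min_mul_cos_le {a b : ℝ} (ha : a ∈ Set.Icc (0 : ℝ) 1) (hb : b ∈ Set.Icc (0 : ℝ) 1) :
    min (1 - a) (1 - b) * Real.cos (Real.pi * b / 2) ≤
      (1 - b) * Real.cos (Real.pi * a / 2) := by
  have hpi := Real.pi_pos
  have hcb : 0 ≤ Real.cos (Real.pi * b / 2) :=
    Real.cos_nonneg_of_mem_Icc ⟨by nlinarith [hb.1, hb.2], by nlinarith [hb.1, hb.2]⟩
  rcases le_or_gt a b with h | h
  · calc min (1 - a) (1 - b) * Real.cos (Real.pi * b / 2)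
        ≤ (1 - b) * Real.cos (Real.pi * b / 2) :=
          mul_le_mul_of_nonneg_right (min_le_right _ _) hcb
      _ ≤ _ := by
          refine mul_le_mul_of_nonneg_left (Real.cos_le_cos_of_nonneg_of_le_pi ?_ ?_ ?_)
            (by linarith [hb.2])
          · nlinarith [ha.1]
          · nlinarith [hb.2]
          · nlinarith
  · rw [min_eq_left (by linarith)]
    have hb1 : 0 < 1 - b := by linarith [ha.2]
    have e : ∀ c : ℝ, Real.cos (Real.pi * c / 2) = Real.sin (Real.pi * (1 - c) / 2) := fun c => by
      rw [← Real.cos_pi_div_two_sub]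
      congr 1
      ring
    -- The sine lies above its chord from `0` to `π (1 - b) / 2`, taken at the fraction `(1 - a) /
    -- (1 - b)` of the way.
    have hconc := strictConcaveOn_sin_Icc.concaveOn.2
      (⟨le_rfl, hpi.le⟩ : (0 : ℝ) ∈ Set.Icc 0 Real.pi)
      (⟨by nlinarith, by nlinarith [hb.1]⟩ : Real.pi * (1 - b) / 2 ∈ Set.Icc 0 Real.pi)
      (by rw [sub_nonneg, div_le_one hb1]; linarith : 0 ≤ 1 - (1 - a) / (1 - b))
      (div_nonneg (by linarith [ha.2]) hb1.le : 0 ≤ (1 - a) / (1 - b)) (by ring)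
    simp only [smul_eq_mul, Real.sin_zero, mul_zero, zero_add] at hconc
    have e2 : (1 - a) / (1 - b) * (Real.pi * (1 - b) / 2) = Real.pi * (1 - a) / 2 := by
      field_simp
    rw [e2, div_mul_eq_mul_div, div_le_iff₀ hb1] at hconc
    rw [e, e]
    linarith

lemma integral_cos_mul_pi_div_two (c : ℝ) :
    ∫ t in (0 : ℝ)..c, Real.cos (Real.pi * t / 2) = 2 / Real.pi * Real.sin (Real.pi * c / 2) := by
  have h : ∀ t : ℝ, Real.cos (Real.pi * t / 2) = Real.cos (Real.pi / 2 * t) := fun t => by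
    congr 1; ring
  have hpi := Real.pi_pos
  simp_rw [h]
  rw [intervalIntegral.integral_comp_mul_left (fun t => Real.cos t) (by positivity), integral_cos]
  simp only [mul_zero, Real.sin_zero, sub_zero, smul_eq_mul, inv_div]
  congr 2
  ring

lemma setLIntegral_ofReal_Icc {f : ℝ → ℝ} (hf : Continuous f) {c : ℝ} (hc : 0 ≤ c)
    (h0 : ∀ t ∈ Set.Icc 0 c, 0 ≤ f t) :
    ∫⁻ t in Set.Icc 0 c, ENNReal.ofReal (f t) = ENNReal.ofReal (∫ t in (0 : ℝ)..c, f t) := by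
  rw [intervalIntegral.integral_of_le hc, ← integral_Icc_eq_integral_Ioc,
    ofReal_integral_eq_lintegral_ofReal hf.integrableOn_Icc
      ((ae_restrict_iff' measurableSet_Icc).2 (Eventually.of_forall h0))]

lemma cos_pi_mul_div_two_nonneg {t : ℝ} (ht : t ∈ Set.Icc (0 : ℝ) 1) :
    0 ≤ Real.cos (Real.pi * t / 2) := by
  have hpi := Real.pi_pos
  exact Real.cos_nonneg_of_mem_Icc ⟨by nlinarith [ht.1, ht.2], by nlinarith [ht.1, ht.2]⟩

/-- As a function of `a`, the volume is obtained by iterating `f ↦ ∫ t in 0..(1 - a), f t`. Once it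
is dominated by a multiple of the eigenfunction `cos (π a / 2)`, each further integration costs a
factor `2 / π`. The multiple, depending on `b`, is the one supplied by `min_mul_cos_le`. -/
lemma volume_isSmallChain_le (m : ℕ) {a b : ℝ} (ha : a ∈ Set.Icc (0 : ℝ) 1)
    (hb : b ∈ Set.Icc (0 : ℝ) 1) :
    volume {x : Fin (m + 1) → ℝ | IsSmallChain (m + 1) a x b} ≤
      ENNReal.ofReal ((1 - b) / Real.cos (Real.pi * b / 2) * (2 / Real.pi) ^ m *
        Real.cos (Real.pi * a / 2)) := by
  have hpi := Real.pi_pos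
  have hcb := cos_pi_mul_div_two_nonneg hb
  induction m generalizing a with
  | zero =>
    have hS : ∀ t : ℝ, volume {x : Fin 0 → ℝ | IsSmallChain 0 t x b} =
        (Set.Iic (1 - b)).indicator 1 t := fun t => by
      by_cases ht : t ≤ 1 - b
      · have h1 : t + b ≤ 1 := by linarith
        have h2 : volume (Set.univ : Set (Fin 0 → ℝ)) = 1 := by
          simpa using volume_pi_pi (fun _ : Fin 0 => (Set.univ : Set ℝ))
        rw [Set.indicator_of_mem (show t ∈ Set.Iic (1 - b) from ht), Pi.one_apply, ← h2]
        exact congrArg _ (Set.eq_univ_of_forall fun _ => h1)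
      · have h1 : ¬ t + b ≤ 1 := by linarith
        simp [IsSmallChain, ht, h1]
    rw [volume_isSmallChain_succ]
    simp_rw [hS]
    have hI : Set.Iic (1 - b) ∩ Set.Icc 0 (1 - a) = Set.Icc 0 (min (1 - a) (1 - b)) := by
      ext t
      simp only [Set.mem_inter_iff, Set.mem_Iic, Set.mem_Icc, le_min_iff]
      tauto
    rw [lintegral_indicator_one measurableSet_Iic, Measure.restrict_apply measurableSet_Iic, hI,
      Real.volume_Icc]
    refine ENNReal.ofReal_le_ofReal ?_
    rw [sub_zero, pow_zero, mul_one, div_mul_eq_mul_div]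
    -- At `b = 1` the quotient is `0` by the convention for division by zero, and the volume `min (1
    -- - a) 0` is bounded by `0` as well.
    rcases hcb.eq_or_lt with h0 | h0
    · have hb1 : b = 1 := by
        by_contra hne
        have : 0 < Real.cos (Real.pi * b / 2) :=
          Real.cos_pos_of_mem_Ioo ⟨by nlinarith [hb.1],
            by nlinarith [lt_of_le_of_ne hb.2 hne]⟩
        linarith
      rw [← h0, div_zero]
      exact (min_le_right _ _).trans (by linarith)
    · rw [le_div_iff₀ h0]
      exact min_mul_cos_le ha hb
  | succ m ih =>
    have hC : 0 ≤ (1 - b) / Real.cos (Real.pi * b / 2) * (2 / Real.pi) ^ m :=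
      mul_nonneg (div_nonneg (by linarith [hb.2]) hcb) (by positivity)
    have hsub : ∀ t ∈ Set.Icc 0 (1 - a), t ∈ Set.Icc (0 : ℝ) 1 :=
      fun t ht => ⟨ht.1, by linarith [ht.2, ha.1]⟩
    rw [volume_isSmallChain_succ]
    refine (setLIntegral_mono' measurableSet_Icc fun t ht => ih (hsub t ht)).trans_eq ?_
    rw [setLIntegral_ofReal_Icc (by fun_prop) (by linarith [ha.2]) fun t ht =>
      mul_nonneg hC (cos_pi_mul_div_two_nonneg (hsub t ht)),
      intervalIntegral.integral_const_mul, integral_cos_mul_pi_div_two]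
    have e : Real.sin (Real.pi * (1 - a) / 2) = Real.cos (Real.pi * a / 2) := by
      rw [← Real.cos_pi_div_two_sub]
      congr 1
      ring
    rw [e]
    congr 1
    ring

/-- The cycle is cut at `x 0 = t`, leaving a chain with both ends `t`. With `a = b = t` the cosines
cancel, and `∫ (1 - t)` over `[0, 1]` gives the factor `1/2`. -/
lemma volume_smallSums_le (m : ℕ) :
    volume (smallSums (m + 2)) ≤ ENNReal.ofReal ((2 / Real.pi) ^ m / 2) := by
  let s : Set (Fin (m + 2) → ℝ) := {x | x 0 ∈ Set.Icc (0 : ℝ) 1} ∩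
    {x | IsSmallChain (m + 1) (x 0) (Fin.tail x) (x 0)}
  have hpi := Real.pi_pos
  have hs : MeasurableSet s := by
    have h0 : Measurable fun x : Fin (m + 2) → ℝ => x 0 := measurable_pi_apply 0
    exact (h0 measurableSet_Icc).inter
      ((h0.prodMk ((measurable_finTail _).prodMk h0)) (measurableSet_isSmallChain (m + 1)))
  have hsub : smallSums (m + 2) ⊆ s := fun x hx => by
    have h1 := mem_unitCube.1 hx.1
    refine ⟨h1 0, isSmallChain_of_forall (fun i => (h1 i.succ).1) fun i => ?_⟩
    rw [Fin.cons_self_tail, Fin.snoc_eq_cons_rotate, Fin.cons_self_tail]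
    exact hx.2 i
  calc volume (smallSums (m + 2)) ≤ volume s := measure_mono hsub
    _ = ∫⁻ t in Set.Icc (0 : ℝ) 1, volume {x : Fin (m + 1) → ℝ | IsSmallChain (m + 1) t x t} := by
        rw [volume_eq_lintegral_cons hs, ← lintegral_indicator measurableSet_Icc]
        congr 1
        ext t
        by_cases ht : t ∈ Set.Icc (0 : ℝ) 1
        · rw [Set.indicator_of_mem ht]
          congr 1
          ext y
          exact and_iff_right ht
        · rw [Set.indicator_of_notMem ht]
          convert measure_empty (μ := (volume : Measure (Fin (m + 1) → ℝ)))
          ext y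
          exact iff_of_false (fun h => ht h.1) id
    _ ≤ ∫⁻ t in Set.Icc (0 : ℝ) 1, ENNReal.ofReal ((2 / Real.pi) ^ m * (1 - t)) := by
        refine setLIntegral_mono' measurableSet_Icc fun t ht =>
          (volume_isSmallChain_le m ht ht).trans (ENNReal.ofReal_le_ofReal ?_)
        rw [mul_comm ((1 - t) / _), mul_assoc]
        refine mul_le_mul_of_nonneg_left ?_ (by positivity)
        rcases eq_or_ne (Real.cos (Real.pi * t / 2)) 0 with h | h
        · simpa [h] using ht.2
        · rw [div_mul_cancel₀ _ h]
    _ = _ := by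
        rw [setLIntegral_ofReal_Icc (by fun_prop) zero_le_one fun t ht =>
          mul_nonneg (by positivity) (by linarith [ht.2])]
        congr 1
        rw [intervalIntegral.integral_const_mul, intervalIntegral.integral_sub (by simp) (by simp)]
        simp
        ring

/-! ### The bounds on the probability. -/

lemma volume_unitCube (n : ℕ) : volume (unitCube n) = 1 := by
  simp [unitCube, Real.volume_Icc_pi]

lemma volume_largeSums_le (n : ℕ) : volume (largeSums n) ≤ volume (smallSums n) := by
  have h := Measure.measurePreserving_sub_left (volume : Measure (Fin n → ℝ)) 1
  have e : MeasurableEmbedding fun x : Fin n → ℝ => 1 - x :=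
    (MeasurableEquiv.subLeft (1 : Fin n → ℝ)).measurableEmbedding
  rw [← h.measure_preimage_emb e]
  exact measure_mono fun x hx => by simpa using one_sub_mem_smallSums hx

lemma cyclicProb_eq {n : ℕ} (hn : 2 ≤ n) :
    cyclicProb n = 1 - (volume : Measure (Fin n → ℝ)).real (unitCube n \ cyclicTuples n) := by
  have hfin : volume (unitCube n) ≠ ⊤ := by simp [volume_unitCube]
  have h := measureReal_inter_add_sdiff₀ (μ := (volume : Measure (Fin n → ℝ)))
    (s := unitCube n) (nullMeasurableSet_cyclicTuples hn) hfin
  rw [Set.inter_eq_self_of_subset_right (cyclicTuples_subset_unitCube n),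
    measureReal_def (s := unitCube n), volume_unitCube n, ENNReal.toReal_one] at h
  rw [cyclicProb]
  linarith

lemma le_cyclicProb {n : ℕ} (hn : 2 ≤ n) : 1 - 3 * (2 / Real.pi) ^ n ≤ cyclicProb n := by
  obtain ⟨m, rfl⟩ : ∃ m, n = m + 2 := ⟨n - 2, by omega⟩
  have hpi := Real.pi_pos
  have h1 : volume (unitCube (m + 2) \ cyclicTuples (m + 2)) ≤
      ENNReal.ofReal ((2 / Real.pi) ^ m) := by
    calc volume (unitCube (m + 2) \ cyclicTuples (m + 2))
        ≤ volume (smallSums (m + 2)) + volume (largeSums (m + 2)) :=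
          (measure_mono (unitCube_diff_cyclicTuples_subset hn)).trans (measure_union_le _ _)
      _ ≤ ENNReal.ofReal ((2 / Real.pi) ^ m / 2) + ENNReal.ofReal ((2 / Real.pi) ^ m / 2) :=
          add_le_add (volume_smallSums_le m)
            ((volume_largeSums_le _).trans (volume_smallSums_le m))
      _ = _ := by
          rw [← ENNReal.ofReal_add (by positivity) (by positivity), add_halves]
  have h2 := ENNReal.toReal_le_of_le_ofReal (by positivity) h1
  rw [cyclicProb_eq hn, Measure.real]
  -- The constant `3` absorbs the two missing factors `2 / π`, since `π ^ 2 ≤ 12`.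
  have h3 : (1 : ℝ) ≤ 3 * (2 / Real.pi) ^ 2 := by
    rw [div_pow, ← mul_div_assoc, le_div_iff₀ (by positivity)]
    nlinarith [Real.pi_lt_d2]
  have h4 : (2 / Real.pi) ^ m ≤ 3 * (2 / Real.pi) ^ (m + 2) := by
    calc (2 / Real.pi) ^ m = (2 / Real.pi) ^ m * 1 := (mul_one _).symm
      _ ≤ (2 / Real.pi) ^ m * (3 * (2 / Real.pi) ^ 2) :=
          mul_le_mul_of_nonneg_left h3 (by positivity)
      _ = _ := by ring
  linarith

lemma cyclicProb_le {n : ℕ} (hn : 2 ≤ n) : cyclicProb n ≤ 1 - 2 * (1 / 4 : ℝ) ^ n := by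
  -- The half-open ends matter: a cyclic tuple has a coordinate at most `3/4` and one at least
  -- `1/4`, so `3/4` and `1/4` themselves are excluded.
  let A : Set (Fin n → ℝ) := Set.univ.pi fun _ => Set.Ioc (3 / 4) 1
  let B : Set (Fin n → ℝ) := Set.univ.pi fun _ => Set.Ico 0 (1 / 4)
  have hA : volume.real A = (1 / 4 : ℝ) ^ n := by
    rw [Measure.real, volume_pi_pi]
    simp [Real.volume_Ioc]
    norm_num [← inv_pow]
  have hB : volume.real B = (1 / 4 : ℝ) ^ n := by
    rw [Measure.real, volume_pi_pi]
    simp [Real.volume_Ico]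
  have hBm : MeasurableSet B := MeasurableSet.univ_pi fun _ => measurableSet_Ico
  have hdisj : Disjoint A B := Set.disjoint_left.2 fun x hxA hxB => by
    have h1 := (hxA ⟨0, by omega⟩ trivial).1
    have h2 := (hxB ⟨0, by omega⟩ trivial).2
    linarith
  have hsub : A ∪ B ⊆ unitCube n \ cyclicTuples n := by
    rintro x (hx | hx)
    · refine ⟨mem_unitCube.2 fun i => ?_, fun hc => ?_⟩
      · have := hx i trivial
        exact ⟨by linarith [this.1], this.2⟩
      · obtain ⟨i, hi⟩ := IsCyclicTuple.exists_le hn hc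
        linarith [(hx i trivial).1]
    · refine ⟨mem_unitCube.2 fun i => ?_, fun hc => ?_⟩
      · have := hx i trivial
        exact ⟨this.1, by linarith [this.2]⟩
      · obtain ⟨i, hi⟩ := IsCyclicTuple.exists_ge hn hc
        linarith [(hx i trivial).2]
  have hfin : ∀ s ⊆ unitCube n, volume s ≠ ⊤ := fun s hs =>
    measure_ne_top_of_subset hs (by simp [volume_unitCube])
  have h1 := measureReal_mono hsub (hfin _ Set.sdiff_subset)
  rw [measureReal_union hdisj hBm
    (hfin _ (Set.subset_union_left.trans (hsub.trans Set.sdiff_subset)))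
    (hfin _ (Set.subset_union_right.trans (hsub.trans Set.sdiff_subset))), hA, hB] at h1
  rw [cyclicProb_eq hn]
  linarith

lemma abs_cyclicProb_sub_one_le {n : ℕ} (hn : 2 ≤ n) :
    |cyclicProb n - 1| ≤ 3 * (2 / Real.pi) ^ n := by
  have h1 := le_cyclicProb hn
  have h2 := cyclicProb_le hn
  have h3 : (0 : ℝ) ≤ (1 / 4) ^ n := by positivity
  have h4 : 0 ≤ (2 / Real.pi) ^ n := pow_nonneg (div_nonneg zero_le_two Real.pi_pos.le) n
  rw [abs_le]
  constructor <;> linarith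

theorem theorem2 :
    (∀ n : ℕ, 4 ≤ n →
      NullMeasurableSet (cyclicTuples n) (volume : Measure (Fin n → ℝ)) ∧
      1 - 3 * (2 / Real.pi) ^ n ≤ cyclicProb n ∧
      cyclicProb n ≤ 1 - 2 * (1 / 4 : ℝ) ^ n) ∧
    Tendsto cyclicProb atTop (𝓝 1) ∧
    ∃ C r : ℝ, 0 < C ∧ 0 < r ∧ r < 1 ∧ ∀ n : ℕ, 4 ≤ n → |cyclicProb n - 1| ≤ C * r ^ n := by
  have hr0 : 0 < 2 / Real.pi := div_pos two_pos Real.pi_pos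
  have hr1 : 2 / Real.pi < 1 := (div_lt_one Real.pi_pos).2 (by linarith [Real.pi_gt_three])
  refine ⟨fun n hn => ⟨nullMeasurableSet_cyclicTuples (by omega), le_cyclicProb (by omega),
    cyclicProb_le (by omega)⟩, ?_, 3, 2 / Real.pi, three_pos, hr0, hr1,
    fun n hn => abs_cyclicProb_sub_one_le (by omega)⟩
  rw [tendsto_iff_norm_sub_tendsto_zero]
  refine squeeze_zero' (Eventually.of_forall fun n => norm_nonneg _)
    ((eventually_ge_atTop 2).mono fun n hn => abs_cyclicProb_sub_one_le hn) ?_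
  simpa using (tendsto_pow_atTop_nhds_zero_of_lt_one hr0.le hr1).const_mul 3
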